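/- Let $n,k\ge 0$ be integers, and let $\mathbb H$ denote the quaternions with units $i,j,\mathbf k$ (the boldface unit $\mathbf k$ is distinguished from the integer $k$). Write $\dagger$ for the conjugate transpose. Let $\mathcal M$ be the set of $(n+k)\times k$ quaternionic matrices $\hat M=\begin{bmatrix}L\\ M\end{bmatrix}$, with $L$ of size $n\times k$ and $M$ of size $k\times k$, such that: - $M=M_1i+M_2j+M_3\mathbf k$ is symmetric ($M^T=M$), with $M_1,M_2,M_3$ real matrices; - $LL^\dagger$ is positive definite; - $L^\dagger L-M^2=I_k$; - for every $x\in\mathbb H$, the matrix $\Delta(x)^\dagger\Delta(x)$ is non-singular, where $\Delta(x)=\begin{bmatrix}L\\ M-I_kx\end{bmatrix}$. Let $\mathrm{Sp}(n)$ be the group of $n\times n$ quaternionic matrices $q$ with $q^\dagger q=qq^\dagger=I_n$, and $\mathrm{Sp}(1)$ the unit quaternions. For $q\in\mathrm{Sp}(n)$, $Q\in\mathrm O(k)$ and $p\in\mathrm{Sp}(1)$ put $$(q,Q).\hat M=\begin{bmatrix}q&0\\0&Q\end{bmatrix}\hat M\,Q^T,\qquad p.\hat M=p\hat Mp^\dagger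 .$$ We say that $\hat M$ is equivariant under $p$ if $p.\hat M=(q,Q).\hat M$ for some $(q,Q)\in\mathrm{Sp}(n)\times\mathrm O(k)$, and that $\hat M$ is axially symmetric about the $z$-axis if it is equivariant under every element of $H_z=\{\sin(\theta/2)\,\mathbf k+\cos(\theta/2)\mid\theta\in[0,4\pi)\}\subseteq\mathrm{Sp}(1)$. Let $\hat M\in\mathcal M$. Then $\hat M$ is axially symmetric about the $z$-axis if and only if there is $Y\in\mathfrak{so}(k)$ with $$[M,Y]=\left[\tfrac{\mathbf k}{2},M\right],$$ where $\left[\tfrac{\mathbf k}{2},M\right]=\tfrac{\mathbf k}{2}M-M\tfrac{\mathbf k}{2}$. Moreover, for each $Y\in\mathfrak{so}(k)$ this equation is equivalent to $$M_1=[M_2,Y],\qquad M_2=[Y,M_1],\qquad [Y,M_3]=0 ,$$ so $\hat M$ is axially symmetric about the $z$-axis if and only if some $Y\in\mathfrak{so}(k)$ satisfies these three equations. -/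

import Mathlib

open scoped Matrix Quaternion

noncomputable section

namespace HyperbolicMonopole

/-- An `(n + k) × k` quaternionic matrix, with the first `n` rows (block `L`) and the last `k` rows
(block `M`) indexed by the two summands of `Fin n ⊕ Fin k`. -/
abbrev Data (n k : ℕ) : Type := Matrix (Fin n ⊕ Fin k) (Fin k) ℍ[ℝ]

/-- The top block `L` of a data matrix. -/
def Data.L {n k : ℕ} (D : Data n k) : Matrix (Fin n) (Fin k) ℍ[ℝ] := Matrix.toRows₁ D

/-- The bottom block `M` of a data matrix. -/
def Data.M {n k : ℕ} (D : Data n k) : Matrix (Fin k) (Fin k) ℍ[ℝ] := Matrix.toRows₂ D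

/-- The quaternionic units. -/
def qi : ℍ[ℝ] := ⟨0, 1, 0, 0⟩

def qj : ℍ[ℝ] := ⟨0, 0, 1, 0⟩

def qk : ℍ[ℝ] := ⟨0, 0, 0, 1⟩

/-- A real matrix regarded as a quaternionic matrix. -/
def ofRealMat {m n : Type*} (A : Matrix m n ℝ) : Matrix m n ℍ[ℝ] := A.map fun t => (t : ℍ[ℝ])

/-- The real coefficient matrices of `i`, `j` and `k` in the block `M`. -/
def Data.M₁ {n k : ℕ} (D : Data n k) : Matrix (Fin k) (Fin k) ℝ := D.M.map fun x => x.imI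

def Data.M₂ {n k : ℕ} (D : Data n k) : Matrix (Fin k) (Fin k) ℝ := D.M.map fun x => x.imJ

def Data.M₃ {n k : ℕ} (D : Data n k) : Matrix (Fin k) (Fin k) ℝ := D.M.map fun x => x.imK

/-- A quaternionic matrix `A` is positive definite: it equals its conjugate transpose, and
`v† A v > 0` for every nonzero column `v` (for such an `A` the number `v† A v` is real). -/
def IsPosDef {n : ℕ} (A : Matrix (Fin n) (Fin n) ℍ[ℝ]) : Prop :=
  A.IsHermitian ∧ ∀ v : Fin n → ℍ[ℝ], v ≠ 0 → 0 < (star v ⬝ᵥ (A *ᵥ v)).re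

/-- The matrix `Δ(x)`, with blocks `L` and `M - I x`. -/
def Data.Delta {n k : ℕ} (D : Data n k) (x : ℍ[ℝ]) : Data n k :=
  Matrix.fromRows D.L (D.M - Matrix.diagonal fun _ => x)

/-- The set `𝓜` of monopole data. -/
def monopoleData (n k : ℕ) : Set (Data n k) :=
  {D | (D.M.IsSymm ∧
        D.M = (ofRealMat D.M₁).map (· * qi) + (ofRealMat D.M₂).map (· * qj)
          + (ofRealMat D.M₃).map (· * qk)) ∧
      IsPosDef (D.L * D.Lᴴ) ∧
      D.Lᴴ * D.L - D.M ^ 2 = 1 ∧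
      ∀ x : ℍ[ℝ], IsUnit ((D.Delta x)ᴴ * D.Delta x)}

/-- The group `Sp(n)` of quaternionic unitary matrices. -/
abbrev Sp (n : ℕ) : Submonoid (Matrix (Fin n) (Fin n) ℍ[ℝ]) := unitary _

/-- The group `Sp(1)` of unit quaternions. -/
abbrev Sp1 : Submonoid ℍ[ℝ] := unitary ℍ[ℝ]

/-- The gauge action `(q, Q).D = diag(q, Q) D Qᵀ`. -/
def gauge {n k : ℕ} (q : Sp n) (Q : Matrix.orthogonalGroup (Fin k) ℝ) (D : Data n k) : Data n k :=
  Matrix.fromBlocks (q : Matrix (Fin n) (Fin n) ℍ[ℝ]) 0 0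
      (ofRealMat (Q : Matrix (Fin k) (Fin k) ℝ)) * D *
    ofRealMat (Q : Matrix (Fin k) (Fin k) ℝ)ᵀ

/-- The rotation action `p.D = p D p†`, entry by entry. -/
def rotate {n k : ℕ} (p : Sp1) (D : Data n k) : Data n k :=
  D.map fun x => (p : ℍ[ℝ]) * x * star (p : ℍ[ℝ])

/-- `D` is equivariant under `p`: rotating `D` by `p` amounts to a gauge action. -/
def IsEquivariant {n k : ℕ} (D : Data n k) (p : Sp1) : Prop :=
  ∃ (q : Sp n) (Q : Matrix.orthogonalGroup (Fin k) ℝ), rotate p D = gauge q Q D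

/-- The set of unit quaternions under which `D` is equivariant. -/
def equivariantSet {n k : ℕ} (D : Data n k) : Set Sp1 := {p | IsEquivariant D p}

/-- The double cover in `Sp(1)` of the group of rotations about the `z`-axis. -/
def Hz : Set Sp1 :=
  {p | ∃ θ ∈ Set.Ico (0 : ℝ) (4 * Real.pi),
    (p : ℍ[ℝ]) = Real.sin (θ / 2) • qk + (Real.cos (θ / 2) : ℍ[ℝ])}

/-- Axial symmetry about the `z`-axis. -/
def IsAxiallySymmetricZ {n k : ℕ} (D : Data n k) : Prop := Hz ⊆ equivariantSet D

/-- The commutator `[u, A] = u A - A u` of a quaternion with a quaternionic matrix. -/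
def quatBracket {k : ℕ} (u : ℍ[ℝ]) (A : Matrix (Fin k) (Fin k) ℍ[ℝ]) :
    Matrix (Fin k) (Fin k) ℍ[ℝ] :=
  A.map fun x => u * x - x * u

/-- The equation `[M, Y] = [k / 2, M]` (here `k` is the quaternionic unit). -/
def GeneratesAxial {n k : ℕ} (D : Data n k) (Y : Matrix (Fin k) (Fin k) ℝ) : Prop :=
  ⁅D.M, ofRealMat Y⁆ = quatBracket ((1 / 2 : ℝ) • qk) D.M

end HyperbolicMonopole

end

/-! Conjugation by `sin (θ/2) k + cos (θ/2)` rotates the `(i, j)`-plane through `θ` and fixes `k`.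
On the block `M`, equivariance under `Hz` therefore says that the rotated triple `(M₁, M₂, M₃)`
stays in its own orbit under conjugation by `O(k)`. The three equations on `Y` are the infinitesimal
form of this.

From symmetry to `Y`: each `Q` depends on `θ` with no continuity assumed, so it cannot be
differentiated. Instead, a differentiable curve inside an orbit of a compact group has its velocity
tangent to the orbit (`exists_skewAdjoint_of_curve_in_orbit`): choose the transporters nearest to
`1`, rescale their distance from `1`, and pass to a limit.

From `Y` to symmetry: `Q = exp (-θ Y)` realises the rotation of `M`. The block `L` follows because
`L†L = 1 + M²` is determined by `M`, and two matrices with equal Gram matrices and invertible `A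
A†`, `B B†` differ by a left unitary factor (`exists_unitary_mul_eq`). -/

namespace HyperbolicMonopole

open Filter Topology

/-! ### Tangent vectors to orbits of a compact unitary group -/

section OrbitTangent

variable {A : Type*} [NormedRing A] [StarRing A] [CStarRing A]

theorem norm_le_of_mem_unitary {u : A} (hu : u ∈ unitary A) : ‖u‖ ≤ 1 := by
  nontriviality A
  exact (CStarRing.norm_of_mem_unitary hu).le

theorem exp_mem_unitary_of_star_eq_neg [NormedAlgebra ℝ A] [CompleteSpace A] {x : A}
    (hx : star x = -x) :
    NormedSpace.exp x ∈ unitary A := by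
  let : NormedAlgebra ℚ A := NormedAlgebra.restrictScalars ℚ ℝ A
  exact NormedSpace.exp_mem_unitary_of_mem_skewAdjoint (skewAdjoint.mem_iff.2 hx)

/-- The unitaries `u` with `u m = g u` for every pair `(m, g)` of two families. -/
def unitaryTransporter {ι : Type*} (m g : ι → A) : Set A :=
  {u | u ∈ unitary A ∧ ∀ i, u * m i = g i * u}

variable [NormedAlgebra ℝ A] [FiniteDimensional ℝ A] {ι : Type*}

theorem isCompact_unitaryTransporter (m g : ι → A) : IsCompact (unitaryTransporter m g) := by
  have : ProperSpace A := FiniteDimensional.proper ℝ A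
  refine Metric.isCompact_of_isClosed_isBounded ?_ ?_
  · have h : unitaryTransporter m g =
        {u | star u * u = 1} ∩ {u | u * star u = 1} ∩ ⋂ i, {u | u * m i = g i * u} := by
      ext u
      simp [unitaryTransporter, Unitary.mem_iff]
    rw [h]
    refine ((isClosed_eq (by fun_prop) (by fun_prop)).inter
      (isClosed_eq (by fun_prop) (by fun_prop))).inter (isClosed_iInter fun i => ?_)
    exact isClosed_eq (by fun_prop) (by fun_prop)
  · refine (Metric.isBounded_closedBall (x := (0 : A)) (r := 1)).subset fun u hu => ?_
    simpa using norm_le_of_mem_unitary hu.1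

/-- Transporters subconverge to some `w` in the stabilizer of `m`. Right multiplication by `star w`
again gives transporters, now tending to `1`, so the nearest ones tend to `1` as well. -/
theorem exists_nearest_tendsto_one {m : ι → A} {γ : ι → ℝ → A}
    (hγ : ∀ i, ContinuousAt (γ i) 0) (h0 : ∀ i, γ i 0 = m i)
    (h : ∀ t ∈ Set.Ioc (0 : ℝ) 1, (unitaryTransporter m fun i => γ i t).Nonempty) :
    ∃ (t : ℕ → ℝ) (u : ℕ → A), (∀ n, 0 < t n) ∧ Tendsto t atTop (𝓝 0) ∧
      Tendsto u atTop (𝓝 1) ∧ ∀ n, u n ∈ unitaryTransporter m (fun i => γ i (t n)) ∧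
        ∀ v ∈ unitaryTransporter m (fun i => γ i (t n)), ‖u n - 1‖ ≤ ‖v - 1‖ := by
  set s : ℕ → ℝ := fun n => 1 / ((n : ℝ) + 1) with hs
  have hspos : ∀ n, 0 < s n := fun n => by positivity
  have hs1 : ∀ n, s n ≤ 1 := fun n => by
    rw [hs]
    exact div_le_one_of_le₀ (by simp) (by positivity)
  have hs0 : Tendsto s atTop (𝓝 0) := tendsto_one_div_add_atTop_nhds_zero_nat
  have hex : ∀ n, ∃ u ∈ unitaryTransporter m (fun i => γ i (s n)),
      IsMinOn (fun v => ‖v - 1‖) (unitaryTransporter m (fun i => γ i (s n))) u := fun n =>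
    (isCompact_unitaryTransporter _ _).exists_isMinOn (h _ ⟨hspos n, hs1 n⟩) (by fun_prop)
  choose u hu hmin using hex
  -- The empty family imposes no relation, so this is compactness of the whole unitary group.
  have hU : IsCompact (unitaryTransporter (fun _ : Empty => (0 : A)) fun _ => 0) :=
    isCompact_unitaryTransporter _ _
  obtain ⟨w, hw, φ, hφ, hlim⟩ := hU.tendsto_subseq (x := u) fun n => ⟨(hu n).1, by simp⟩
  have hsφ : Tendsto (fun n => s (φ n)) atTop (𝓝 0) := hs0.comp hφ.tendsto_atTop
  have hwm : ∀ i, w * m i = m i * w := fun i => by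
    have h1 : Tendsto (fun n => u (φ n) * m i) atTop (𝓝 (w * m i)) := hlim.mul_const _
    have h2 : Tendsto (fun n => γ i (s (φ n)) * u (φ n)) atTop (𝓝 (m i * w)) := by
      have := (hγ i).tendsto.comp hsφ
      rw [h0] at this
      exact this.mul hlim
    refine tendsto_nhds_unique h1 (h2.congr fun n => ((hu (φ n)).2 i).symm)
  have hw1 : star w * w = 1 := (Unitary.mem_iff.1 hw.1).1
  have hw2 : w * star w = 1 := (Unitary.mem_iff.1 hw.1).2
  have hwm' : ∀ i, m i * star w = star w * m i := fun i => by
    calc m i * star w = star w * w * m i * star w := by rw [hw1, one_mul]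
      _ = star w * m i := by rw [mul_assoc (star w), hwm, ← mul_assoc, mul_assoc, hw2, mul_one]
  refine ⟨fun n => s (φ n), fun n => u (φ n), fun n => hspos _, hsφ, ?_, fun n => ⟨hu _, hmin _⟩⟩
  rw [tendsto_iff_norm_sub_tendsto_zero]
  have hlim' : Tendsto (fun n => ‖u (φ n) * star w - 1‖) atTop (𝓝 0) := by
    have := (hlim.mul_const (star w)).sub_const 1
    simpa [hw2] using this.norm
  refine squeeze_zero (fun _ => norm_nonneg _) (fun n => hmin (φ n) ?_) hlim'
  refine ⟨mul_mem (hu _).1 (Unitary.star_mem hw.1), fun i => ?_⟩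
  rw [mul_assoc, ← hwm', ← mul_assoc, (hu _).2, mul_assoc]

/-- The tangent at `0` of a curve in the conjugation orbit of a family `m` under a compact
unitary group is tangent to the orbit. -/
theorem exists_skewAdjoint_of_curve_in_orbit [StarModule ℝ A] {m w : ι → A} {γ : ι → ℝ → A}
    (hγ : ∀ i, HasDerivAt (γ i) (w i) 0) (h0 : ∀ i, γ i 0 = m i)
    (h : ∀ t ∈ Set.Ioc (0 : ℝ) 1, (unitaryTransporter m fun i => γ i t).Nonempty) :
    ∃ y : A, star y = -y ∧ ∀ i, y * m i - m i * y = w i := by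
  have : ProperSpace A := FiniteDimensional.proper ℝ A
  have : CompleteSpace A := FiniteDimensional.complete ℝ A
  obtain ⟨t, u, htpos, ht0, hu1, hu⟩ :=
    exists_nearest_tendsto_one (fun i => (hγ i).continuousAt) h0 h
  -- Dividing by `t + ‖u - 1‖` keeps both `(u - 1) / r` and `t / r` bounded, and their norms add up
  -- to `1`, so the two limits cannot both vanish.
  set r : ℕ → ℝ := fun n => t n + ‖u n - 1‖ with hr
  have hrpos : ∀ n, 0 < r n := fun n => by have := htpos n; positivity
  have hr0 : Tendsto r atTop (𝓝 0) := by
    simpa using ht0.add (tendsto_iff_norm_sub_tendsto_zero.1 hu1)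
  set z : ℕ → A := fun n => (r n)⁻¹ • (u n - 1) with hz
  have hznorm : ∀ n, ‖z n‖ = 1 - t n / r n := fun n => by
    have h1 : ‖u n - 1‖ = r n - t n := by simp [hr]
    rw [hz, norm_smul, h1, norm_inv, Real.norm_of_nonneg (hrpos n).le]
    field_simp [(hrpos n).ne']
  have hbd : ∀ n, (z n, t n / r n) ∈ Metric.closedBall (0 : A) 1 ×ˢ Set.Icc (0 : ℝ) 1 := fun n => by
    have h1 : 0 ≤ t n / r n := by have := htpos n; have := hrpos n; positivity
    have h2 := norm_nonneg (z n)
    have h3 := hznorm n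
    refine ⟨?_, h1, ?_⟩
    · simp only [mem_closedBall_zero_iff]
      linarith
    · simp only
      linarith
  obtain ⟨⟨Z, τ⟩, -, φ, hφ, hlim⟩ :=
    ((isCompact_closedBall (0 : A) 1).prod isCompact_Icc).tendsto_subseq hbd
  have hZ : Tendsto (fun n => z (φ n)) atTop (𝓝 Z) := (continuous_fst.tendsto _).comp hlim
  have hτ : Tendsto (fun n => t (φ n) / r (φ n)) atTop (𝓝 τ) := (continuous_snd.tendsto _).comp hlim
  have hu1' : Tendsto (fun n => u (φ n)) atTop (𝓝 1) := hu1.comp hφ.tendsto_atTop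
  have hr0' : Tendsto (fun n => r (φ n)) atTop (𝓝 0) := hr0.comp hφ.tendsto_atTop
  have ht0' : Tendsto (fun n => t (φ n)) atTop (𝓝[≠] 0) :=
    tendsto_nhdsWithin_iff.2 ⟨ht0.comp hφ.tendsto_atTop, .of_forall fun n => (htpos _).ne'⟩
  have hr0'' : Tendsto (fun n => r (φ n)) atTop (𝓝[≠] 0) :=
    tendsto_nhdsWithin_iff.2 ⟨hr0', .of_forall fun n => (hrpos _).ne'⟩
  have hskew : star Z = -Z := by
    have h1 : Tendsto (fun n => star (z (φ n)) * u (φ n) + z (φ n)) atTop (𝓝 (star Z * 1 + Z)) :=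
      (hZ.star.mul hu1').add hZ
    have h2 : ∀ n, star (z (φ n)) * u (φ n) + z (φ n) = 0 := fun n => by
      have h3 := (Unitary.mem_iff.1 (hu (φ n)).1.1).1
      simp only [hz, star_smul, star_sub, star_one, star_trivial, smul_mul_assoc, ← smul_add, sub_mul, h3, one_mul]
      simp
    simp only [h2, mul_one] at h1
    exact eq_neg_of_add_eq_zero_left (tendsto_nhds_unique h1 tendsto_const_nhds)
  have hcomm : ∀ i, Z * m i - m i * Z = τ • w i := fun i => by
    have h1 : Tendsto (fun n => z (φ n) * m i - m i * z (φ n)) atTop (𝓝 (Z * m i - m i * Z)) :=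
      (hZ.mul_const _).sub (hZ.const_mul _)
    have h2 := (hasDerivAt_iff_tendsto_slope_zero.1 (hγ i)).comp ht0'
    have h3 := hτ.smul (h2.mul hu1')
    rw [mul_one] at h3
    -- Since `u m = γ(t) u`, the commutator of `(u - 1) / r` with `m` is `t / r` times the
    -- difference quotient of `γ`, times `u`.
    refine tendsto_nhds_unique h1 (h3.congr fun n => ?_)
    have h4 := (hu (φ n)).1.2 i
    have h5 := (htpos (φ n)).ne'
    simp only [Function.comp, zero_add, h0, hz, smul_mul_assoc, mul_smul_comm, ← smul_sub, smul_smul]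
    congr 1
    · field_simp
    · rw [sub_mul, sub_mul, mul_sub, one_mul, mul_one, h4]
      abel
  -- If `τ = 0`, then `Z` has norm `1` and commutes with `m`, so `u exp (-r Z)` is still a
  -- transporter. Its distance to `1` is `o(r)`, whereas that of `u` is asymptotic to `r`,
  -- contradicting minimality.
  rcases eq_or_ne τ 0 with rfl | hτ0
  · exfalso
    have hZ1 : ‖Z‖ = 1 := by
      refine tendsto_nhds_unique hZ.norm ?_
      simp only [hznorm]
      simpa using hτ.const_sub 1
    set e : ℝ → A := fun x => NormedSpace.exp (x • -Z) with he
    have hed : HasDerivAt e (-Z) 0 := by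
      have := hasDerivAt_exp_smul_const (𝕂 := ℝ) (-Z) 0
      rwa [zero_smul, NormedSpace.exp_zero, one_mul] at this
    have he0 : e 0 = 1 := by simp [he]
    have he1 : Tendsto (fun n => e (r (φ n))) atTop (𝓝 1) := by
      have := hed.continuousAt.tendsto.comp hr0'
      rwa [he0] at this
    have hes := (hasDerivAt_iff_tendsto_slope_zero.1 hed).comp hr0''
    have hlim0 := (hZ.mul he1).add hes
    rw [mul_one, add_neg_cancel] at hlim0
    have hle : ∀ n, ‖z (φ n)‖ ≤ ‖z (φ n) * e (r (φ n)) +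
        (r (φ n))⁻¹ • (e (0 + r (φ n)) - e 0)‖ := fun n => by
      have hmem : u (φ n) * e (r (φ n)) ∈ unitaryTransporter m (fun i => γ i (t (φ n))) := by
        refine ⟨mul_mem (hu _).1.1 (exp_mem_unitary_of_star_eq_neg ?_), fun i => ?_⟩
        · simp [star_smul, hskew]
        · have hc : Commute (m i) (r (φ n) • -Z) := by
            have := hcomm i
            rw [zero_smul, sub_eq_zero] at this
            exact (Commute.neg_right this.symm).smul_right _
          have hc' : m i * e (r (φ n)) = e (r (φ n)) * m i := hc.exp_right
          rw [mul_assoc, ← hc', ← mul_assoc, (hu _).1.2, mul_assoc]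
      have h1 := (hu (φ n)).2 _ hmem
      have h2 : z (φ n) * e (r (φ n)) + (r (φ n))⁻¹ • (e (0 + r (φ n)) - e 0) =
          (r (φ n))⁻¹ • (u (φ n) * e (r (φ n)) - 1) := by
        rw [zero_add, he0, hz, smul_mul_assoc, ← smul_add, sub_mul, one_mul]
        abel_nf
      rw [h2, hz, norm_smul, norm_smul]
      gcongr
    have h3 := le_of_tendsto_of_tendsto hZ.norm hlim0.norm (.of_forall hle)
    rw [hZ1, norm_zero] at h3
    linarith
  · refine ⟨τ⁻¹ • Z, by simp [star_smul, hskew], fun i => ?_⟩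
    rw [smul_mul_assoc, mul_smul_comm, ← smul_sub, hcomm, smul_smul, inv_mul_cancel₀ hτ0, one_smul]

end OrbitTangent

/-! ### Conjugation by one-parameter groups -/

/-- A curve solving `γ' = [y, γ]` is given by conjugation with `exp (t y)`. -/
theorem exp_smul_mul_eq_of_hasDerivAt {A : Type*} [NormedRing A] [NormedAlgebra ℝ A]
    [FiniteDimensional ℝ A] {y : A} {γ : ℝ → A}
    (hγ : ∀ t, HasDerivAt γ (y * γ t - γ t * y) t) (t : ℝ) :
    NormedSpace.exp (t • y) * γ 0 = γ t * NormedSpace.exp (t • y) := by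
  have : CompleteSpace A := FiniteDimensional.complete ℝ A
  let : NormedAlgebra ℚ A := NormedAlgebra.restrictScalars ℚ ℝ A
  have hexp : ∀ s : ℝ, NormedSpace.exp (s • y) * NormedSpace.exp (s • -y) = 1 := fun s => by
    rw [← NormedSpace.exp_add_of_commute]
    · simp
    · exact ((Commute.refl y).neg_right.smul_right s).smul_left s
  have hd : ∀ s : ℝ, HasDerivAt
      (fun s => NormedSpace.exp (s • -y) * γ s * NormedSpace.exp (s • y)) 0 s := fun s => by
    have h1 := hasDerivAt_exp_smul_const (𝕂 := ℝ) (-y) s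
    have h2 := hasDerivAt_exp_smul_const' (𝕂 := ℝ) y s
    refine ((h1.mul (hγ s)).mul h2).congr_deriv ?_
    change (_ + _) * _ + NormedSpace.exp (s • -y) * γ s * _ = 0
    noncomm_ring
  -- The conjugate `exp (-s y) γ(s) exp (s y)` has zero derivative, hence keeps its value at `0`.
  have hc := is_const_of_deriv_eq_zero (fun s => (hd s).differentiableAt) (fun s => (hd s).deriv) 0 t
  simp only [zero_smul, NormedSpace.exp_zero, one_mul, mul_one] at hc
  rw [hc, ← mul_assoc, ← mul_assoc, hexp, one_mul]

theorem hasDerivAt_cos_smul_add_sin_smul {E : Type*} [NormedAddCommGroup E] [NormedSpace ℝ E]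
    (a b : E) (t : ℝ) :
    HasDerivAt (fun s => Real.cos s • a + Real.sin s • b) (Real.cos t • b - Real.sin t • a) t := by
  refine (((Real.hasDerivAt_cos t).smul_const a).add
    ((Real.hasDerivAt_sin t).smul_const b)).congr_deriv ?_
  module

theorem exp_smul_mul_eq_cos_smul_add_sin_smul_mul {A : Type*} [NormedRing A] [NormedAlgebra ℝ A]
    [FiniteDimensional ℝ A] {y a b : A} (hab : y * a - a * y = b) (hba : y * b - b * y = -a)
    (t : ℝ) :
    NormedSpace.exp (t • y) * a =
      (Real.cos t • a + Real.sin t • b) * NormedSpace.exp (t • y) := by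
  have h := exp_smul_mul_eq_of_hasDerivAt (y := y)
    (γ := fun s => Real.cos s • a + Real.sin s • b) (fun s =>
      (hasDerivAt_cos_smul_add_sin_smul a b s).congr_deriv ?_) t
  · simpa using h
  · have h1 : y * (Real.cos s • a + Real.sin s • b) - (Real.cos s • a + Real.sin s • b) * y =
        Real.cos s • (y * a - a * y) + Real.sin s • (y * b - b * y) := by
      simp only [mul_add, add_mul, mul_smul_comm, smul_mul_assoc]
      module
    rw [h1, hab, hba]
    module

/-! ### Quaternionic matrices and Gram matrices -/

section Quaternionic

@[simp] theorem re_qk : qk.re = 0 := rfl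

@[simp] theorem imI_qk : qk.imI = 0 := rfl

@[simp] theorem imJ_qk : qk.imJ = 0 := rfl

@[simp] theorem imK_qk : qk.imK = 1 := rfl

theorem map_ofRealMat_mul [Fintype n] (f : ℍ[ℝ] →ₗ[ℝ] ℝ) (A : Matrix m n ℝ) (N : Matrix n o ℍ[ℝ]) :
    (ofRealMat A * N).map f = A * N.map f := by
  ext a b
  simp [Matrix.mul_apply, ofRealMat, Quaternion.coe_mul_eq_smul]

theorem map_mul_ofRealMat [Fintype n] (f : ℍ[ℝ] →ₗ[ℝ] ℝ) (N : Matrix m n ℍ[ℝ]) (A : Matrix n o ℝ) :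
    (N * ofRealMat A).map f = N.map f * A := by
  ext a b
  simp [Matrix.mul_apply, ofRealMat, Quaternion.mul_coe_eq_smul, mul_comm]

theorem quaternionMat_ext_iff {A B : Matrix m n ℍ[ℝ]} :
    A = B ↔ A.map (fun x => x.re) = B.map (fun x => x.re) ∧
      A.map (fun x => x.imI) = B.map (fun x => x.imI) ∧
      A.map (fun x => x.imJ) = B.map (fun x => x.imJ) ∧
      A.map (fun x => x.imK) = B.map (fun x => x.imK) := by
  simp only [← Matrix.ext_iff, Matrix.map_apply, Quaternion.ext_iff, forall_and]

theorem ofRealMat_mul [Fintype n] (A : Matrix m n ℝ) (B : Matrix n o ℝ) :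
    ofRealMat (A * B) = ofRealMat A * ofRealMat B :=
  Matrix.map_mul (f := algebraMap ℝ ℍ[ℝ])

theorem ofRealMat_one [DecidableEq n] : ofRealMat (1 : Matrix n n ℝ) = 1 := by
  exact Matrix.map_one _ rfl rfl

theorem conjTranspose_ofRealMat (A : Matrix m n ℝ) : (ofRealMat A)ᴴ = ofRealMat Aᵀ := by
  ext a b : 1
  simp [ofRealMat]

theorem map_mul_mul_eq_diagonal_mul [Fintype m] [Fintype o] [DecidableEq m]
    [DecidableEq o] (u v : ℍ[ℝ]) (N : Matrix m o ℍ[ℝ]) :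
    N.map (fun x => u * x * v) =
      (Matrix.diagonal (fun _ => u) : Matrix m m ℍ[ℝ]) * N *
        (Matrix.diagonal (fun _ => v) : Matrix o o ℍ[ℝ]) := by
  ext a b : 1
  simp

/-- Left multiplication by `A` is a real-linear endomorphism of a finite-dimensional space.
Definiteness, applied to columns, makes it injective, so it is surjective and reaches `1`. -/
theorem IsPosDef.exists_mul_eq_one {n : ℕ} {A : Matrix (Fin n) (Fin n) ℍ[ℝ]} (hA : IsPosDef A) :
    ∃ B, A * B = 1 := by
  have hinj : Function.Injective (LinearMap.mulLeft ℝ A) := by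
    rw [← LinearMap.ker_eq_bot, LinearMap.ker_eq_bot']
    intro X hX
    ext a b : 1
    by_contra hne
    have h0 : A *ᵥ X.col b = 0 := by
      ext c : 1
      exact congrFun (congrFun hX c) b
    have := hA.2 (X.col b) fun h => hne (congrFun h a)
    simp [h0] at this
  exact LinearMap.injective_iff_surjective.1 hinj 1

/-- The factor is `q = A B† (B B†)⁻¹`. Equality of the Gram matrices gives `q† q = 1`; invertibility
of `A A†` lets `q B = A` be checked after multiplying by `A A†`. -/
theorem exists_unitary_mul_eq [Fintype o] {n : ℕ} {A B : Matrix (Fin n) o ℍ[ℝ]} (h : Aᴴ * A = Bᴴ * B)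
    (hA : ∃ X, A * Aᴴ * X = 1) (hB : ∃ X, B * Bᴴ * X = 1) : ∃ q : Sp n, A = (q : Matrix (Fin n) (Fin n) ℍ[ℝ]) * B := by
  obtain ⟨X, hX⟩ := hA
  obtain ⟨Y, hY⟩ := hB
  have hX' := mul_eq_one_comm.1 hX
  have hY' := mul_eq_one_comm.1 hY
  have hYs : Yᴴ = Y := by
    have h1 : Yᴴ * (B * Bᴴ) = 1 := by
      have := congrArg Matrix.conjTranspose hY
      simpa [Matrix.conjTranspose_mul, Matrix.mul_assoc] using this
    calc Yᴴ = Yᴴ * (B * Bᴴ * Y) := by rw [hY, Matrix.mul_one]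
      _ = Y := by rw [← Matrix.mul_assoc, h1, Matrix.one_mul]
  have hqB : A * Bᴴ * Y * B = A := by
    calc A * Bᴴ * Y * B = X * (A * Aᴴ) * (A * Bᴴ * Y * B) := by rw [hX', Matrix.one_mul]
      _ = X * (A * (Aᴴ * A) * (Bᴴ * Y * B)) := by simp only [Matrix.mul_assoc]
      _ = X * (A * Bᴴ * (B * Bᴴ * Y) * B) := by rw [h]; simp only [Matrix.mul_assoc]
      _ = X * (A * (Bᴴ * B)) := by rw [hY, Matrix.mul_one, Matrix.mul_assoc A]
      _ = X * (A * Aᴴ) * A := by rw [← h]; simp only [Matrix.mul_assoc]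
      _ = A := by rw [hX', Matrix.one_mul]
  have hq : star (A * Bᴴ * Y) * (A * Bᴴ * Y) = 1 := by
    calc star (A * Bᴴ * Y) * (A * Bᴴ * Y) = Y * B * (Aᴴ * A) * Bᴴ * Y := by
          simp [Matrix.star_eq_conjTranspose, Matrix.conjTranspose_mul, hYs, Matrix.mul_assoc]
      _ = Y * (B * Bᴴ) * (B * Bᴴ * Y) := by rw [h]; simp only [Matrix.mul_assoc]
      _ = 1 := by rw [hY, hY', Matrix.one_mul]
  exact ⟨⟨A * Bᴴ * Y, Unitary.mem_iff.2 ⟨hq, mul_eq_one_comm.1 hq⟩⟩, hqB.symm⟩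

theorem exists_unitary_mul_mul_eq {n k : ℕ} {L : Matrix (Fin n) (Fin k) ℍ[ℝ]}
    {M V R : Matrix (Fin k) (Fin k) ℍ[ℝ]} {U : Matrix (Fin n) (Fin n) ℍ[ℝ]}
    (hLM : Lᴴ * L - M ^ 2 = 1) (hL : ∃ X, L * Lᴴ * X = 1) (hU : U ∈ Sp n) (hV : V ∈ Sp k)
    (hR : R ∈ Sp k) (hM : V * M * Vᴴ = R * M * Rᴴ) :
    ∃ q : Sp n, U * L * Vᴴ = (q : Matrix (Fin n) (Fin n) ℍ[ℝ]) * L * Rᴴ := by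
  obtain ⟨hU1, hU2⟩ := Unitary.mem_iff.1 hU
  obtain ⟨hV1, hV2⟩ := Unitary.mem_iff.1 hV
  obtain ⟨hR1, hR2⟩ := Unitary.mem_iff.1 hR
  rw [Matrix.star_eq_conjTranspose] at hU1 hU2 hV1 hV2 hR1 hR2
  have hLM' : Lᴴ * L = 1 + M * M := by rw [← hLM, pow_two, sub_add_cancel]
  -- A unitary conjugate of `L†L` depends only on the same conjugate of `M`; this turns `hM` into
  -- equality of Gram matrices.
  have key : ∀ W : Matrix (Fin k) (Fin k) ℍ[ℝ], Wᴴ * W = 1 → W * Wᴴ = 1 →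
      W * (Lᴴ * L) * Wᴴ = 1 + (W * M * Wᴴ) * (W * M * Wᴴ) := fun W h1 h2 => by
    calc W * (Lᴴ * L) * Wᴴ = W * Wᴴ + W * M * 1 * (M * Wᴴ) := by
          rw [hLM']; noncomm_ring
      _ = 1 + (W * M * Wᴴ) * (W * M * Wᴴ) := by rw [h2, ← h1]; noncomm_ring
  have h : (U * L * Vᴴ)ᴴ * (U * L * Vᴴ) = (L * Rᴴ)ᴴ * (L * Rᴴ) := by
    calc (U * L * Vᴴ)ᴴ * (U * L * Vᴴ) = V * (Lᴴ * ((Uᴴ * U) * L)) * Vᴴ := by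
          simp [Matrix.conjTranspose_mul, Matrix.mul_assoc]
      _ = R * (Lᴴ * L) * Rᴴ := by rw [hU1, Matrix.one_mul, key V hV1 hV2, hM, key R hR1 hR2]
      _ = (L * Rᴴ)ᴴ * (L * Rᴴ) := by simp [Matrix.conjTranspose_mul, Matrix.mul_assoc]
  obtain ⟨X, hX⟩ := hL
  obtain ⟨q, hq⟩ := exists_unitary_mul_eq h ⟨U * X * Uᴴ, by
      calc U * L * Vᴴ * (U * L * Vᴴ)ᴴ * (U * X * Uᴴ)
          = U * (L * ((Vᴴ * V) * (Lᴴ * ((Uᴴ * U) * X)))) * Uᴴ := by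
            simp [Matrix.conjTranspose_mul, Matrix.mul_assoc]
        _ = U * (L * Lᴴ * X) * Uᴴ := by simp [hU1, hV1, Matrix.mul_assoc]
        _ = 1 := by rw [hX, Matrix.mul_one, hU2]⟩ ⟨X, by
      calc L * Rᴴ * (L * Rᴴ)ᴴ * X = L * ((Rᴴ * R) * Lᴴ) * X := by
            simp [Matrix.conjTranspose_mul, Matrix.mul_assoc]
        _ = 1 := by rw [hR1, Matrix.one_mul, hX]⟩
  exact ⟨q, by rw [hq, Matrix.mul_assoc]⟩

end Quaternionic

/-! ### Axial symmetry of monopole data -/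

section Data

variable {n k : ℕ}

theorem rotate_eq_gauge_iff (D : Data n k) (p : Sp1) (q : Sp n)
    (Q : Matrix.orthogonalGroup (Fin k) ℝ) :
    rotate p D = gauge q Q D ↔
      D.L.map (fun x => (p : ℍ[ℝ]) * x * star (p : ℍ[ℝ])) =
          (q : Matrix (Fin n) (Fin n) ℍ[ℝ]) * D.L * ofRealMat (Q : Matrix (Fin k) (Fin k) ℝ)ᵀ ∧
      D.M.map (fun x => (p : ℍ[ℝ]) * x * star (p : ℍ[ℝ])) =
        ofRealMat (Q : Matrix (Fin k) (Fin k) ℝ) * D.M *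
          ofRealMat (Q : Matrix (Fin k) (Fin k) ℝ)ᵀ := by
  have h1 : rotate p D = Matrix.fromRows
      (D.L.map fun x => (p : ℍ[ℝ]) * x * star (p : ℍ[ℝ]))
      (D.M.map fun x => (p : ℍ[ℝ]) * x * star (p : ℍ[ℝ])) := by
    ext (a | a) b : 1 <;> rfl
  have h2 : gauge q Q D = Matrix.fromRows
      ((q : Matrix (Fin n) (Fin n) ℍ[ℝ]) * D.L * ofRealMat (Q : Matrix (Fin k) (Fin k) ℝ)ᵀ)
      (ofRealMat (Q : Matrix (Fin k) (Fin k) ℝ) * D.M *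
          ofRealMat (Q : Matrix (Fin k) (Fin k) ℝ)ᵀ) := by
    have hD : D = Matrix.fromRows D.L D.M := (Matrix.fromRows_toRows D).symm
    rw [gauge]
    conv_lhs => rw [hD]
    rw [Matrix.fromBlocks_mul_fromRows, Matrix.fromRows_mul]
    simp
  rw [h1, h2, Matrix.fromRows_ext_iff]

theorem map_re_eq_zero {D : Data n k} (hD : D ∈ monopoleData n k) :
    D.M.map (fun x => x.re) = 0 := by
  rw [hD.1.2]
  ext a b
  simp [ofRealMat, show qi.re = 0 from rfl, show qj.re = 0 from rfl]

theorem re_M_apply {D : Data n k} (hD : D ∈ monopoleData n k) (a b : Fin k) :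
    (D.M a b).re = 0 :=
  congrFun (congrFun (map_re_eq_zero hD) a) b

theorem map_rotation_eq_iff {D : Data n k} (hD : D ∈ monopoleData n k) {p : ℍ[ℝ]} {θ : ℝ}
    (hp : p = Real.sin (θ / 2) • qk + (Real.cos (θ / 2) : ℍ[ℝ])) (Q : Matrix (Fin k) (Fin k) ℝ) :
    D.M.map (fun x => p * x * star p) = ofRealMat Q * D.M * ofRealMat Qᵀ ↔
      Q * D.M₁ * Qᵀ = Real.cos θ • D.M₁ - Real.sin θ • D.M₂ ∧
      Q * D.M₂ * Qᵀ = Real.sin θ • D.M₁ + Real.cos θ • D.M₂ ∧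
      Q * D.M₃ * Qᵀ = D.M₃ := by
  have hcomp : ∀ f : ℍ[ℝ] →ₗ[ℝ] ℝ, (ofRealMat Q * D.M * ofRealMat Qᵀ).map f =
      Q * D.M.map f * Qᵀ := fun f => by
    rw [map_mul_ofRealMat, map_ofRealMat_mul]
  have e0 : (ofRealMat Q * D.M * ofRealMat Qᵀ).map (fun x => x.re) = 0 := by
    refine (hcomp (QuaternionAlgebra.reₗ _ _ _)).trans ?_
    change Q * D.M.map (fun x => x.re) * Qᵀ = 0
    rw [map_re_eq_zero hD, Matrix.mul_zero, Matrix.zero_mul]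
  have e1 : (ofRealMat Q * D.M * ofRealMat Qᵀ).map (fun x => x.imI) = Q * D.M₁ * Qᵀ :=
    hcomp (QuaternionAlgebra.imIₗ _ _ _)
  have e2 : (ofRealMat Q * D.M * ofRealMat Qᵀ).map (fun x => x.imJ) = Q * D.M₂ * Qᵀ :=
    hcomp (QuaternionAlgebra.imJₗ _ _ _)
  have e3 : (ofRealMat Q * D.M * ofRealMat Qᵀ).map (fun x => x.imK) = Q * D.M₃ * Qᵀ :=
    hcomp (QuaternionAlgebra.imKₗ _ _ _)
  -- Conjugation by `p` is quadratic in the half-angle functions; the double-angle formulas turn it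
  -- into a rotation through `θ`.
  have hθ : θ = 2 * (θ / 2) := by ring
  have hcs := Real.sin_sq_add_cos_sq (θ / 2)
  have hc : Real.cos θ = Real.cos (θ / 2) ^ 2 - Real.sin (θ / 2) ^ 2 := by
    conv_lhs => rw [hθ, Real.cos_two_mul']
  have hs : Real.sin θ = 2 * Real.sin (θ / 2) * Real.cos (θ / 2) := by
    conv_lhs => rw [hθ, Real.sin_two_mul]
  have f0 : (D.M.map (fun x => p * x * star p)).map (fun x => x.re) = 0 := by
    ext a b
    simp [hp, re_M_apply hD]
    ring
  have f1 : (D.M.map (fun x => p * x * star p)).map (fun x => x.imI) =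
      Real.cos θ • D.M₁ - Real.sin θ • D.M₂ := by
    ext a b
    simp [hp, re_M_apply hD, hc, hs, Data.M₁, Data.M₂]
    ring
  have f2 : (D.M.map (fun x => p * x * star p)).map (fun x => x.imJ) =
      Real.sin θ • D.M₁ + Real.cos θ • D.M₂ := by
    ext a b
    simp [hp, re_M_apply hD, hc, hs, Data.M₁, Data.M₂]
    ring
  have f3 : (D.M.map (fun x => p * x * star p)).map (fun x => x.imK) = D.M₃ := by
    ext a b
    simp [hp, re_M_apply hD, Data.M₃]
    linear_combination (D.M a b).imK * hcs
  rw [quaternionMat_ext_iff, e0, e1, e2, e3, f0, f1, f2, f3]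
  simp only [true_and, eq_comm]

/-- The bracket with `k/2` sends `i` to `j` and `j` to `-i`, and kills `k` and the reals; the
components of the equation are then compared. -/
theorem generatesAxial_iff {D : Data n k} (hD : D ∈ monopoleData n k)
    (Y : Matrix (Fin k) (Fin k) ℝ) :
    GeneratesAxial D Y ↔ D.M₁ = ⁅D.M₂, Y⁆ ∧ D.M₂ = ⁅Y, D.M₁⁆ ∧ ⁅Y, D.M₃⁆ = 0 := by
  have hcomp : ∀ f : ℍ[ℝ] →ₗ[ℝ] ℝ, (⁅D.M, ofRealMat Y⁆).map f = ⁅D.M.map f, Y⁆ := fun f => by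
    rw [Ring.lie_def, Ring.lie_def, ← map_mul_ofRealMat, ← map_ofRealMat_mul]
    exact Matrix.map_sub _ (map_sub f) _ _
  have e0 : (⁅D.M, ofRealMat Y⁆).map (fun x => x.re) = 0 := by
    refine (hcomp (QuaternionAlgebra.reₗ _ _ _)).trans ?_
    change ⁅D.M.map (fun x => x.re), Y⁆ = 0
    rw [map_re_eq_zero hD, Ring.lie_def, Matrix.zero_mul, Matrix.mul_zero, sub_zero]
  have e1 : (⁅D.M, ofRealMat Y⁆).map (fun x => x.imI) = ⁅D.M₁, Y⁆ :=
    hcomp (QuaternionAlgebra.imIₗ _ _ _)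
  have e2 : (⁅D.M, ofRealMat Y⁆).map (fun x => x.imJ) = ⁅D.M₂, Y⁆ :=
    hcomp (QuaternionAlgebra.imJₗ _ _ _)
  have e3 : (⁅D.M, ofRealMat Y⁆).map (fun x => x.imK) = ⁅D.M₃, Y⁆ :=
    hcomp (QuaternionAlgebra.imKₗ _ _ _)
  have f0 : (quatBracket ((1 / 2 : ℝ) • qk) D.M).map (fun x => x.re) = 0 := by
    ext a b
    simp [quatBracket]
  have f1 : (quatBracket ((1 / 2 : ℝ) • qk) D.M).map (fun x => x.imI) = -D.M₂ := by
    ext a b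
    simp [quatBracket, Data.M₂]
    ring
  have f2 : (quatBracket ((1 / 2 : ℝ) • qk) D.M).map (fun x => x.imJ) = D.M₁ := by
    ext a b
    simp [quatBracket, Data.M₁]
    ring
  have f3 : (quatBracket ((1 / 2 : ℝ) • qk) D.M).map (fun x => x.imK) = 0 := by
    ext a b
    simp [quatBracket]
  have lie_antisymm : ∀ N : Matrix (Fin k) (Fin k) ℝ, ⁅N, Y⁆ = -⁅Y, N⁆ := fun N => by
    rw [Ring.lie_def, Ring.lie_def, neg_sub]
  rw [GeneratesAxial, quaternionMat_ext_iff, e0, e1, e2, e3, f0, f1, f2, f3,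
    lie_antisymm D.M₁, lie_antisymm D.M₃, neg_inj, neg_eq_zero]
  simp only [true_and, eq_comm (b := D.M₁), eq_comm (b := D.M₂)]
  tauto

theorem sin_smul_qk_add_cos_mem_Sp1 (t : ℝ) :
    Real.sin t • qk + (Real.cos t : ℍ[ℝ]) ∈ Sp1 := by
  have h := Real.sin_sq_add_cos_sq t
  rw [Unitary.mem_iff]
  constructor <;> ext <;> simp  <;> linarith

open scoped Matrix.Norms.L2Operator in
theorem exists_generator_of_isAxiallySymmetricZ {D : Data n k} (hD : D ∈ monopoleData n k)
    (h : IsAxiallySymmetricZ D) :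
    ∃ Y ∈ LieAlgebra.Orthogonal.so (Fin k) ℝ,
      D.M₁ = ⁅D.M₂, Y⁆ ∧ D.M₂ = ⁅Y, D.M₁⁆ ∧ ⁅Y, D.M₃⁆ = 0 := by
  set γ : Fin 3 → ℝ → Matrix (Fin k) (Fin k) ℝ :=
    ![fun t => Real.cos t • D.M₁ + Real.sin t • -D.M₂,
      fun t => Real.cos t • D.M₂ + Real.sin t • D.M₁, fun _ => D.M₃] with hγ
  obtain ⟨y, hy, hyw⟩ := exists_skewAdjoint_of_curve_in_orbit (m := ![D.M₁, D.M₂, D.M₃])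
    (w := ![-D.M₂, D.M₁, 0]) (γ := γ) (fun i => by
      fin_cases i
      · exact (hasDerivAt_cos_smul_add_sin_smul D.M₁ (-D.M₂) 0).congr_deriv (by simp)
      · exact (hasDerivAt_cos_smul_add_sin_smul D.M₂ D.M₁ 0).congr_deriv (by simp)
      · exact hasDerivAt_const (0 : ℝ) D.M₃)
    (fun i => by fin_cases i <;> simp [hγ])
    (fun t ht => by
      obtain ⟨q, Q, hQ⟩ := @h ⟨_, sin_smul_qk_add_cos_mem_Sp1 (t / 2)⟩ ⟨t, ⟨ht.1.le, by
        have := Real.pi_gt_three; have := ht.2; linarith⟩, rfl⟩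
      obtain ⟨h1, h2, h3⟩ := (map_rotation_eq_iff hD rfl _).1 ((rotate_eq_gauge_iff _ _ _ _).1 hQ).2
      have hQQ : (Q : Matrix (Fin k) (Fin k) ℝ)ᵀ * (Q : Matrix (Fin k) (Fin k) ℝ) = 1 :=
        (Unitary.mem_iff.1 Q.2).1
      refine ⟨Q, Q.2, fun i => ?_⟩
      fin_cases i
      · change Q.1 * D.M₁ = (Real.cos t • D.M₁ + Real.sin t • -D.M₂) * Q.1
        rw [smul_neg, ← sub_eq_add_neg, ← h1, Matrix.mul_assoc, hQQ, Matrix.mul_one]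
      · change Q.1 * D.M₂ = (Real.cos t • D.M₂ + Real.sin t • D.M₁) * Q.1
        rw [add_comm, ← h2, Matrix.mul_assoc, hQQ, Matrix.mul_one]
      · change Q.1 * D.M₃ = D.M₃ * Q.1
        nth_rw 2 [← h3]
        simp [Matrix.mul_assoc, hQQ])
  have h1 : y * D.M₁ - D.M₁ * y = -D.M₂ := hyw 0
  have h2 : y * D.M₂ - D.M₂ * y = D.M₁ := hyw 1
  have h3 : y * D.M₃ - D.M₃ * y = 0 := hyw 2
  -- The sign changes because `Q` moves `M` in the direction `[y, M]`, while the equation is stated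
  -- with `[M, Y]`.
  refine ⟨-y, ?_, ?_, ?_, ?_⟩
  · have : yᵀ = -y := hy
    simp [this]
  · rw [Ring.lie_def, ← h2, Matrix.mul_neg, Matrix.neg_mul]
    abel
  · rw [Ring.lie_def, ← neg_neg D.M₂, ← h1, Matrix.mul_neg, Matrix.neg_mul]
    abel
  · rw [Ring.lie_def, ← neg_zero, ← h3, Matrix.mul_neg, Matrix.neg_mul]
    abel

open scoped Matrix.Norms.L2Operator in
theorem isAxiallySymmetricZ_of_generator {D : Data n k} (hD : D ∈ monopoleData n k)
    {Y : Matrix (Fin k) (Fin k) ℝ} (hY : Y ∈ LieAlgebra.Orthogonal.so (Fin k) ℝ)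
    (h1 : D.M₁ = ⁅D.M₂, Y⁆) (h2 : D.M₂ = ⁅Y, D.M₁⁆) (h3 : ⁅Y, D.M₃⁆ = 0) :
    IsAxiallySymmetricZ D := by
  rintro p ⟨θ, -, hp⟩
  rw [LieAlgebra.Orthogonal.mem_so] at hY
  have g1 : D.M₁ = D.M₂ * Y - Y * D.M₂ := h1
  have g2 : D.M₂ = Y * D.M₁ - D.M₁ * Y := h2
  have g3 : Y * D.M₃ - D.M₃ * Y = 0 := h3
  have hskew : star ((-θ) • Y) = -((-θ) • Y) := by
    rw [star_smul, Matrix.star_eq_conjTranspose, Matrix.conjTranspose_eq_transpose_of_trivial, hY]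
    simp
  set Q : Matrix.orthogonalGroup (Fin k) ℝ :=
    ⟨NormedSpace.exp ((-θ) • Y), exp_mem_unitary_of_star_eq_neg hskew⟩ with hQ
  have hQQ : Q.1 * Q.1ᵀ = 1 := (Unitary.mem_iff.1 Q.2).2
  have hQQ' : Q.1ᵀ * Q.1 = 1 := (Unitary.mem_iff.1 Q.2).1
  have e1 : Q.1 * D.M₁ * Q.1ᵀ = Real.cos θ • D.M₁ - Real.sin θ • D.M₂ := by
    have : Q.1 * D.M₁ = (Real.cos (-θ) • D.M₁ + Real.sin (-θ) • D.M₂) * Q.1 :=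
      exp_smul_mul_eq_cos_smul_add_sin_smul_mul g2.symm
        ((neg_sub _ _).symm.trans (congrArg _ g1.symm)) _
    rw [this, Matrix.mul_assoc, hQQ, Matrix.mul_one, Real.cos_neg, Real.sin_neg, neg_smul,
      sub_eq_add_neg]
  have e2 : Q.1 * D.M₂ * Q.1ᵀ = Real.sin θ • D.M₁ + Real.cos θ • D.M₂ := by
    have : Q.1 * D.M₂ = (Real.cos (-θ) • D.M₂ + Real.sin (-θ) • -D.M₁) * Q.1 :=
      exp_smul_mul_eq_cos_smul_add_sin_smul_mul
        ((neg_sub _ _).symm.trans (congrArg _ g1.symm)) (by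
          rw [mul_neg, neg_mul, ← neg_sub', ← g2]) _
    rw [this, Matrix.mul_assoc, hQQ, Matrix.mul_one, Real.cos_neg, Real.sin_neg, neg_smul,
      smul_neg, neg_neg, add_comm]
  have e3 : Q.1 * D.M₃ * Q.1ᵀ = D.M₃ := by
    have := exp_smul_mul_eq_of_hasDerivAt (y := Y) (γ := fun _ => D.M₃)
      (fun t => (hasDerivAt_const t D.M₃).congr_deriv g3.symm) (-θ)
    change Q.1 * D.M₃ = D.M₃ * Q.1 at this
    rw [this, Matrix.mul_assoc, hQQ, Matrix.mul_one]
  have hM := (map_rotation_eq_iff hD hp Q.1).2 ⟨e1, e2, e3⟩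
  have hpu := Unitary.mem_iff.1 p.2
  -- The rotation by `p` is written as multiplication by scalar diagonal matrices on both sides, of
  -- sizes `n` and `k`.
  obtain ⟨q, hq⟩ := exists_unitary_mul_mul_eq (L := D.L) (M := D.M) hD.2.2.1 hD.2.1.exists_mul_eq_one
    (U := Matrix.diagonal fun _ => (p : ℍ[ℝ])) (V := Matrix.diagonal fun _ => (p : ℍ[ℝ]))
    (R := ofRealMat Q.1)
    (by simp [Unitary.mem_iff, Matrix.star_eq_conjTranspose, Matrix.diagonal_conjTranspose, hpu])
    (by simp [Unitary.mem_iff, Matrix.star_eq_conjTranspose, Matrix.diagonal_conjTranspose, hpu])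
    (by simp [Unitary.mem_iff, Matrix.star_eq_conjTranspose, conjTranspose_ofRealMat,
      ← ofRealMat_mul, hQQ, hQQ', ofRealMat_one])
    (by
      rw [map_mul_mul_eq_diagonal_mul] at hM
      rw [conjTranspose_ofRealMat, ← hM, Matrix.diagonal_conjTranspose]
      rfl)
  refine ⟨q, Q, (rotate_eq_gauge_iff _ _ _ _).2 ⟨?_, hM⟩⟩
  rw [map_mul_mul_eq_diagonal_mul, ← conjTranspose_ofRealMat, ← hq, Matrix.diagonal_conjTranspose]
  rfl

end Data

end HyperbolicMonopole

theorem mainTheorem3 (n k : ℕ) (D : HyperbolicMonopole.Data n k)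
    (hD : D ∈ HyperbolicMonopole.monopoleData n k) :
    (HyperbolicMonopole.IsAxiallySymmetricZ D ↔
      ∃ Y ∈ LieAlgebra.Orthogonal.so (Fin k) ℝ, HyperbolicMonopole.GeneratesAxial D Y) ∧
    (HyperbolicMonopole.IsAxiallySymmetricZ D ↔
      ∃ Y ∈ LieAlgebra.Orthogonal.so (Fin k) ℝ,
        D.M₁ = ⁅D.M₂, Y⁆ ∧ D.M₂ = ⁅Y, D.M₁⁆ ∧ ⁅Y, D.M₃⁆ = 0) ∧
    (∀ Y ∈ LieAlgebra.Orthogonal.so (Fin k) ℝ,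
      HyperbolicMonopole.GeneratesAxial D Y ↔
        D.M₁ = ⁅D.M₂, Y⁆ ∧ D.M₂ = ⁅Y, D.M₁⁆ ∧ ⁅Y, D.M₃⁆ = 0) := by
  have hiff := HyperbolicMonopole.generatesAxial_iff hD
  have h : HyperbolicMonopole.IsAxiallySymmetricZ D ↔
      ∃ Y ∈ LieAlgebra.Orthogonal.so (Fin k) ℝ,
        D.M₁ = ⁅D.M₂, Y⁆ ∧ D.M₂ = ⁅Y, D.M₁⁆ ∧ ⁅Y, D.M₃⁆ = 0 :=
    ⟨HyperbolicMonopole.exists_generator_of_isAxiallySymmetricZ hD, fun ⟨_, hY, h1, h2, h3⟩ =>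
      HyperbolicMonopole.isAxiallySymmetricZ_of_generator hD hY h1 h2 h3⟩
  exact ⟨by simpa only [hiff] using h, h, fun Y _ => hiff Y⟩
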